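/- Let $H$ be a separable infinite-dimensional complex Hilbert space and let $\mathcal C(H)=\mathcal B(H)/\mathcal K(H)$ be the Calkin algebra, where $\mathcal K(H)$ is the ideal of compact operators. A *formula* over a C*-algebra $A$ is an expression in variables $x_0,x_1,\dots$ that is built from the atomic formulas $\|P(\bar x)\|$, with $P$ a *-polynomial with coefficients in $A$, by continuous real-valued functions of finitely many formulas and by suprema and infima in which one variable ranges over a ball of $A$ of natural-number radius centred at $0$. Two formulas that define the same function on $A^{\mathbb N}$ are identified. A *countable type* over $A$ is a countable set of conditions $\varphi(\bar x)\in K$ with $\varphi$ a formula over $A$ and $K\subseteq\mathbb R$ compact. The type is *realized* in $A$ if some $b_0,b_1,\dots$ in the unit ball of $A$ satisfy all its conditions. It is *finitely approximately realizable* if for every finite subset $S$ of it and every $\varepsilon>0$ there are $b_0,b_1,\dots$ in the unit ball of $A$ such that $\operatorname{dist}(\varphi(\bar b),K)\le\varepsilon$ for every condition $\varphi(\bar x)\in K$ in $S$. The algebra $A$ is *countably saturated* if a countable type over $A$ is realized in $A$ exactly when it is finitely approximately realizable in $A$. A *supernatural number* is a formal product $n=\prod_p p^{k_p}$ over all primes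 with $k_p\in\{0,1,2,\dots,\infty\}$, and divisibility is comparison of exponents. For a supernatural number $n$ let $\mathbf t(n)$ be the set of the following conditions, where $k\ge 1$ is a natural number: 1. $x_0x_0^*=1$ and $x_0^*x_0=1$; 2. $x_k^k=x_0$ whenever $k$ divides $n$; 3. $\inf_{\|y\|=1}\|y^k-x_0\|\ge 1$ whenever $k$ does not divide $n$ (for $x_0$ in the unit ball the infimum is at most $2$, so this is the condition that it lies in the compact set $[1,2]$). **Proposition.** (a) For every supernatural number $n$, $\mathbf t(n)$ is a countable type over $\mathcal C(H)$ and is finitely approximately realizable in $\mathcal C(H)$. (b) If $n$ is neither a natural number nor $\prod_p p^\infty$ (that is, infinitely many natural numbers divide $n$, but not all positive ones do), then $\mathbf t(n)$ is not realized in $\mathcal C(H)$. (c) In particular, the Calkin algebra is not countably saturated. -/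

import Mathlib

/-! ### The Calkin algebra -/

section Calkin

variable (H : Type*) [NormedAddCommGroup H] [InnerProductSpace ℂ H] [CompleteSpace H]

/-- The ideal `K(H)` of compact operators in the algebra `B(H)` of bounded operators on `H`. -/
def compactIdeal : Ideal (H →L[ℂ] H) where
  carrier := {T | IsCompactOperator T}
  add_mem' hS hT := hS.add hT
  zero_mem' := isCompactOperator_zero
  smul_mem' c _ hT := hT.clm_comp c

instance compactIdeal_isTwoSided : (compactIdeal H).IsTwoSided where
  mul_mem_of_left b ha := IsCompactOperator.comp_clm ha b

instance compactIdeal_isClosed : IsClosed (compactIdeal H : Set (H →L[ℂ] H)) :=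
  isClosed_setOfPred_isCompactOperator

variable {H} in
/-- The adjoint of a compact operator is compact. -/
theorem star_mem_compactIdeal {T : H →L[ℂ] H} (hT : T ∈ compactIdeal H) :
    star T ∈ compactIdeal H := by
  have hS : IsCompactOperator ((T * star T : H →L[ℂ] H) : H →ₗ[ℂ] H) :=
    IsCompactOperator.comp_clm (f := T) hT (star T)
  have hb : TotallyBounded ((T * star T : H →L[ℂ] H) '' Metric.closedBall (0 : H) 1) :=
    ((hS.isCompact_closure_image_closedBall 1).totallyBounded).subset subset_closure
  change IsCompactOperator ((star T : H →L[ℂ] H) : H →ₗ[ℂ] H)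
  rw [isCompactOperator_iff_isCompact_closure_image_closedBall _ zero_lt_one]
  refine TotallyBounded.isCompact_of_isClosed (TotallyBounded.closure ?_) isClosed_closure
  rw [Metric.totallyBounded_iff]
  intro ε hε
  obtain ⟨t, hts, htf, hcov⟩ :=
    Metric.finite_approx_of_totallyBounded hb (ε ^ 2 / 2) (by positivity)
  have hpre : ∀ y ∈ t, ∃ x ∈ Metric.closedBall (0 : H) 1, (T * star T : H →L[ℂ] H) x = y := hts
  choose! g hg hgt using hpre
  refine ⟨(fun y => (star T : H →L[ℂ] H) (g y)) '' t, htf.image _, ?_⟩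
  rintro _ ⟨x, hx, rfl⟩
  obtain ⟨y, hy, hxy⟩ := Set.mem_iUnion₂.1 (hcov (Set.mem_image_of_mem _ hx))
  refine Set.mem_iUnion₂.2 ⟨_, Set.mem_image_of_mem _ hy, ?_⟩
  rw [← hgt _ hy, Metric.mem_ball, dist_eq_norm, ← map_sub] at hxy
  change dist ((star T : H →L[ℂ] H) x) ((star T : H →L[ℂ] H) (g y)) < ε
  rw [dist_eq_norm, ← map_sub]
  have hz : ‖x - g y‖ ≤ 2 := by
    have h1 := mem_closedBall_zero_iff.1 hx
    have h2 := mem_closedBall_zero_iff.1 (hg _ hy)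
    linarith [norm_sub_le x (g y)]
  have key : ‖(star T : H →L[ℂ] H) (x - g y)‖ ^ 2
      ≤ ‖(T * star T : H →L[ℂ] H) (x - g y)‖ * ‖x - g y‖ := by
    rw [← inner_self_eq_norm_sq (𝕜 := ℂ)]
    have : inner ℂ ((star T : H →L[ℂ] H) (x - g y)) ((star T : H →L[ℂ] H) (x - g y))
        = inner ℂ ((T * star T : H →L[ℂ] H) (x - g y)) (x - g y) := by
      rw [ContinuousLinearMap.star_eq_adjoint, ContinuousLinearMap.adjoint_inner_right]
      rfl
    rw [this]
    exact (Complex.re_le_norm _).trans (norm_inner_le_norm _ _)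
  refine lt_of_pow_lt_pow_left₀ 2 hε.le ?_
  nlinarith [norm_nonneg ((T * star T : H →L[ℂ] H) (x - g y)), norm_nonneg (x - g y)]

/-- The Calkin algebra `B(H) / K(H)`, with the quotient operations and the quotient norm. -/
abbrev CalkinAlgebra : Type _ := (H →L[ℂ] H) ⧸ compactIdeal H

noncomputable instance : NormedRing (CalkinAlgebra H) where
  __ := Ideal.Quotient.ring (compactIdeal H)
  __ := Submodule.Quotient.normedAddCommGroup (compactIdeal H)
  norm_mul_le x y := le_of_forall_pos_le_add fun ε hε => by
    have hc : Filter.Tendsto (fun δ : ℝ => (‖x‖ + δ) * (‖y‖ + δ)) (nhdsWithin 0 (Set.Ioi 0))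
        (nhds (‖x‖ * ‖y‖)) := by
      have : Continuous fun δ : ℝ => (‖x‖ + δ) * (‖y‖ + δ) := by fun_prop
      simpa using (this.tendsto 0).mono_left nhdsWithin_le_nhds
    obtain ⟨δ, h, hδ⟩ := ((hc.eventually_lt_const (lt_add_of_pos_right _ hε)).and
      self_mem_nhdsWithin).exists
    obtain ⟨a, rfl, ha⟩ := Submodule.Quotient.norm_mk_lt x hδ
    obtain ⟨b, rfl, hb⟩ := Submodule.Quotient.norm_mk_lt y hδ
    exact (Submodule.Quotient.norm_mk_le (compactIdeal H) (a * b)).trans <|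
      (norm_mul_le a b).trans <| (mul_le_mul ha.le hb.le (norm_nonneg _)
        ((norm_nonneg _).trans ha.le)).trans h.le

noncomputable instance : NormedAlgebra ℂ (CalkinAlgebra H) where
  __ := Ideal.Quotient.algebra ℂ (I := compactIdeal H)
  norm_smul_le c x := (Submodule.Quotient.normedSpace (compactIdeal H) ℂ).norm_smul_le c x

/-- The involution `[T]* = [T*]`. -/
noncomputable instance : StarRing (CalkinAlgebra H) where
  star := Quotient.map' (fun T => star T) fun S T h => by
    rw [Submodule.quotientRel_def] at h ⊢
    rw [← star_sub]
    exact star_mem_compactIdeal h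
  star_involutive := by
    rintro ⟨T⟩
    exact congrArg (Ideal.Quotient.mk (compactIdeal H)) (star_star T)
  star_mul := by
    rintro ⟨S⟩ ⟨T⟩
    exact congrArg (Ideal.Quotient.mk (compactIdeal H)) (star_mul S T)
  star_add := by
    rintro ⟨S⟩ ⟨T⟩
    exact congrArg (Ideal.Quotient.mk (compactIdeal H)) (star_add S T)

end Calkin

/-! ### Types and countable saturation in the logic for metric structures -/

section Logic

variable (A : Type*) [NormedRing A] [StarRing A]

/-- The *-polynomials `P(x̄)` with coefficients in `A`, in the variables `x_j`, `j ∈ ℕ`, as functions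
of the value `x : ℕ → A` of the variables. -/
inductive IsStarPolynomial : ((ℕ → A) → A) → Prop
  | var (j : ℕ) : IsStarPolynomial fun x => x j
  | const (a : A) : IsStarPolynomial fun _ => a
  | add {P Q : (ℕ → A) → A} (hP : IsStarPolynomial P) (hQ : IsStarPolynomial Q) :
      IsStarPolynomial fun x => P x + Q x
  | mul {P Q : (ℕ → A) → A} (hP : IsStarPolynomial P) (hQ : IsStarPolynomial Q) :
      IsStarPolynomial fun x => P x * Q x
  | star {P : (ℕ → A) → A} (hP : IsStarPolynomial P) : IsStarPolynomial fun x => star (P x)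

/-- The formulas of the logic for metric structures with parameters in `A`, as functions of the
value of the variables: the atomic formulas `‖P(x̄)‖` for *-polynomials `P`, continuous real
functions of finitely many formulas, and suprema and infima of formulas in which one variable ranges
over a ball of `A` of radius a natural number, centred at `0`. -/
inductive IsFormula : ((ℕ → A) → ℝ) → Prop
  | norm {P : (ℕ → A) → A} (hP : IsStarPolynomial A P) : IsFormula fun x => ‖P x‖
  | connective {m : ℕ} {F : (Fin m → ℝ) → ℝ} (hF : Continuous F) {φ : Fin m → (ℕ → A) → ℝ}
      (hφ : ∀ i, IsFormula (φ i)) : IsFormula fun x => F fun i => φ i x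
  | iSup {φ : (ℕ → A) → ℝ} (hφ : IsFormula φ) (j r : ℕ) :
      IsFormula fun x => ⨆ y : Metric.closedBall (0 : A) r, φ (Function.update x j y)
  | iInf {φ : (ℕ → A) → ℝ} (hφ : IsFormula φ) (j r : ℕ) :
      IsFormula fun x => ⨅ y : Metric.closedBall (0 : A) r, φ (Function.update x j y)

/-- An expression `φ(x̄) ∈ K`. -/
structure Condition where
  φ : (ℕ → A) → ℝ
  K : Set ℝ

variable {A}

/-- `T` is a countable type over `A`: a countable set of conditions `φ(x̄) ∈ K` with `φ` a formula
with parameters in `A` and `K` a compact set of reals. -/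
def IsCountableType (T : Set (Condition A)) : Prop :=
  T.Countable ∧ ∀ c ∈ T, IsFormula A c.φ ∧ IsCompact c.K

/-- `T` is realized in `A`: elements `b_0, b_1, …` of the unit ball satisfy all conditions. -/
def IsRealized (T : Set (Condition A)) : Prop :=
  ∃ b : ℕ → A, (∀ j, ‖b j‖ ≤ 1) ∧ ∀ c ∈ T, c.φ b ∈ c.K

/-- `T` is finitely approximately realizable in `A`: for every finite `S ⊆ T` and every `ε > 0`
there are elements of the unit ball such that `φ(b̄)` has distance at most `ε` from `K` for every
condition `φ(x̄) ∈ K` in `S`. -/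
def IsFinitelyApproximatelyRealizable (T : Set (Condition A)) : Prop :=
  ∀ S ⊆ T, S.Finite → ∀ ε : ℝ, 0 < ε →
    ∃ b : ℕ → A, (∀ j, ‖b j‖ ≤ 1) ∧ ∀ c ∈ S, c.φ b ∈ Metric.cthickening ε c.K

variable (A) in
/-- Countable saturation: every countable type over `A` is realized in `A` if and only if it is
finitely approximately realizable in `A`. -/
def IsCountablySaturated : Prop :=
  ∀ T : Set (Condition A), IsCountableType T →
    (IsRealized T ↔ IsFinitelyApproximatelyRealizable T)

end Logic

/-! ### Supernatural numbers and the type `t(n)` -/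

/-- A supernatural number `∏ p ^ (n p)`, given by its exponents `n p ∈ {0, 1, 2, …, ∞}`. -/
abbrev Supernatural : Type := Nat.Primes → ℕ∞

/-- Divisibility of supernatural numbers. -/
def Supernatural.Divides (m n : Supernatural) : Prop := ∀ p, m p ≤ n p

/-- A positive natural number as a supernatural number. -/
def Supernatural.ofPNat (k : ℕ+) : Supernatural := fun p => ((k : ℕ).factorization p : ℕ∞)

section RootType

variable (A : Type*) [NormedRing A] [StarRing A]

/-- The type `t(n)`: `x₀` is unitary, `x_k ^ k = x₀` for every `k ≥ 1` that divides `n`, and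
`inf {‖y ^ k - x₀‖ : ‖y‖ = 1} ≥ 1` for every `k ≥ 1` that does not divide `n`. The infimum never
exceeds `2` when `x₀` lies in the unit ball, so that the last condition is written with the compact
set `[1, 2]`. -/
def rootType (n : Supernatural) : Set (Condition A) :=
  {⟨fun x => ‖x 0 * star (x 0) - 1‖, {0}⟩, ⟨fun x => ‖star (x 0) * x 0 - 1‖, {0}⟩} ∪
  {c | ∃ k : ℕ+, (Supernatural.ofPNat k).Divides n ∧
    c = ⟨fun x => ‖x k ^ (k : ℕ) - x 0‖, {0}⟩} ∪
  {c | ∃ k : ℕ+, ¬ (Supernatural.ofPNat k).Divides n ∧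
    c = ⟨fun x => ⨅ y : Metric.sphere (0 : A) 1, ‖(y : A) ^ (k : ℕ) - x 0‖, Set.Icc 1 2⟩}

end RootType

/-! The obstruction is the index. Call a unit of the Calkin algebra liftable if it is the image of
an invertible operator, and let `s` be the image of an isometry `S` of corank one. Modulo the
liftable units, the group of units is infinite cyclic, generated by `s`; this gives a homomorphism
`ind` to the integers with kernel the liftable units and `ind s = 1` (`exists_index`).

Finitely many conditions involve finitely many divisors `k` of `n`, and these have a common multiple
`m` that still divides `n`. Then `x₀ = s ^ m`, `x_k = s ^ (m / k)` works: a `k`-th power at distance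
less than 1 from `s ^ m` has index `m`, so `k ∣ m` and `k` divides `n` (`dvd_of_norm_pow_sub_lt`).

In a realization, every natural divisor of `n` divides `ind x₀`. If these divisors are unbounded,
the index is 0 and `x₀` lifts to an invertible operator, hence, by polar decomposition, to a unitary
(`exists_unitary_lift`). A unitary operator has roots of all orders (`exists_unitary_root`), which
contradicts condition 3 for any `k` that does not divide `n`. -/

namespace Calkin

/-! ### The quotient map and liftable units -/

variable {H : Type*} [NormedAddCommGroup H] [InnerProductSpace ℂ H]

variable (H) in
/-- The quotient map `B(H) → C(H)`. -/
noncomputable abbrev π : (H →L[ℂ] H) →+* CalkinAlgebra H := Ideal.Quotient.mk (compactIdeal H)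

theorem π_surjective : Function.Surjective (π H) := Ideal.Quotient.mk_surjective

theorem π_eq_zero_iff {T : H →L[ℂ] H} : π H T = 0 ↔ IsCompactOperator T :=
  Ideal.Quotient.eq_zero_iff_mem

theorem π_eq_iff {S T : H →L[ℂ] H} : π H S = π H T ↔ IsCompactOperator (S - T : H →L[ℂ] H) := by
  rw [← sub_eq_zero, ← map_sub, π_eq_zero_iff]

theorem one_ne_zero_of_infinite (hH : ¬ FiniteDimensional ℂ H) : (1 : CalkinAlgebra H) ≠ 0 := by
  intro h
  rw [← map_one (π H), π_eq_zero_iff] at h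
  exact hH (FiniteDimensional.of_isCompactOperator_id (𝕜 := ℂ) h)

variable (H) in
/-- The units of the Calkin algebra that lift to invertible operators. -/
noncomputable def liftable : Subgroup (CalkinAlgebra H)ˣ :=
  (Units.map (π H : (H →L[ℂ] H) →* CalkinAlgebra H)).range

theorem mem_liftable {x : (CalkinAlgebra H)ˣ} :
    x ∈ liftable H ↔ ∃ V : (H →L[ℂ] H)ˣ, π H V = x := by
  simp only [liftable, MonoidHom.mem_range, Units.ext_iff]
  rfl

open Filter Topology in
-- Provides closed range. If unit vectors satisfy `T xₙ → 0`, then along a subsequence `(R T - 1)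
-- xₙ` converges by compactness, hence so does `xₙ`; its limit is a unit vector killed by `T`.
theorem exists_antilipschitz {T R : H →L[ℂ] H} (h : π H R * π H T = 1)
    (hT : Function.Injective T) : ∃ K, AntilipschitzWith K T := by
  have hK : IsCompactOperator (R * T - 1 : H →L[ℂ] H) := by
    rw [← π_eq_iff, map_mul, h, map_one]
  rw [antilipschitzWith_iff_exists_mul_le_norm]
  by_contra! hc
  have hc' : ∀ n : ℕ, ∃ x : H, ‖x‖ = 1 ∧ ‖T x‖ < 1 / (n + 1) := by
    intro n
    obtain ⟨x, hx⟩ := hc (1 / (n + 1)) (by positivity)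
    have hx0 : x ≠ 0 := by
      rintro rfl
      simp at hx
    have hxn : 0 < ‖x‖ := norm_pos_iff.2 hx0
    refine ⟨((‖x‖⁻¹ : ℝ) : ℂ) • x, ?_, ?_⟩
    · simp [norm_smul, hxn.ne']
    · rw [map_smul, norm_smul]
      simp only [Complex.norm_real, norm_inv, norm_norm]
      rw [inv_mul_lt_iff₀ hxn, mul_comm]
      exact hx
  choose x hx1 hx2 using hc'
  have hTx : Tendsto (fun n => T (x n)) atTop (𝓝 0) :=
    squeeze_zero_norm (fun n => (hx2 n).le) tendsto_one_div_add_atTop_nhds_zero_nat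
  obtain ⟨C, hC, hC'⟩ := hK.image_closedBall_subset_compact 1
  obtain ⟨y, -, ψ, hψ, hψy⟩ := hC.tendsto_subseq (fun n => hC' ⟨x n, by simp [hx1], rfl⟩)
  have hxψ : Tendsto (fun n => x (ψ n)) atTop (𝓝 (-y)) := by
    have h1 := ((R.continuous.tendsto 0).comp (hTx.comp hψ.tendsto_atTop)).sub hψy
    simpa using h1
  have hy1 : ‖-y‖ = 1 := tendsto_nhds_unique hxψ.norm (by simp [hx1])
  have hy0 : T (-y) = 0 :=
    tendsto_nhds_unique ((T.continuous.tendsto _).comp hxψ) (hTx.comp hψ.tendsto_atTop)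
  rw [hT (hy0.trans (map_zero T).symm)] at hy1
  simp at hy1

variable [CompleteSpace H]

theorem π_star (T : H →L[ℂ] H) : π H (star T) = star (π H T) := rfl

theorem norm_π_le (T : H →L[ℂ] H) : ‖π H T‖ ≤ ‖T‖ :=
  Submodule.Quotient.norm_mk_le (compactIdeal H) T

theorem norm_one_eq (hH : ¬ FiniteDimensional ℂ H) : ‖(1 : CalkinAlgebra H)‖ = 1 := by
  refine le_antisymm ?_ ?_
  · rw [← map_one (π H)]
    exact (norm_π_le _).trans ContinuousLinearMap.norm_id_le
  · have h0 : 0 < ‖(1 : CalkinAlgebra H)‖ := norm_pos_iff.2 (one_ne_zero_of_infinite hH)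
    have h1 := norm_mul_le (1 : CalkinAlgebra H) 1
    rw [mul_one] at h1
    nlinarith

theorem norm_π_of_mem_unitary (hH : ¬ FiniteDimensional ℂ H) {U : H →L[ℂ] H}
    (hU : U ∈ unitary (H →L[ℂ] H)) : ‖π H U‖ = 1 := by
  have key : ∀ V ∈ unitary (H →L[ℂ] H), ‖π H V‖ ≤ 1 := fun V hV =>
    (norm_π_le V).trans <| V.opNorm_le_bound zero_le_one fun v => by
      rw [ContinuousLinearMap.norm_map_of_mem_unitary hV, one_mul]
  refine le_antisymm (key U hU) ?_
  have h1 : π H (star U) * π H U = 1 := by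
    rw [← map_mul, Unitary.star_mul_self_of_mem hU, map_one]
  have h2 := norm_mul_le (π H (star U)) (π H U)
  rw [h1, norm_one_eq hH] at h2
  nlinarith [key _ (Unitary.star_mem hU), norm_nonneg (π H U)]

/-- The quotient norm lets `x - 1` be lifted to some `R` with `‖R‖ < 1`, and `1 + R` is invertible
by the Neumann series. -/
theorem exists_unit_lift_of_norm_sub_one_lt {x : CalkinAlgebra H} (hx : ‖x - 1‖ < 1) :
    ∃ V : (H →L[ℂ] H)ˣ, π H V = x := by
  obtain ⟨R, hR, hR1⟩ := Submodule.Quotient.norm_mk_lt (x - 1) (sub_pos.2 hx)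
  rw [add_sub_cancel] at hR1
  have hR' : π H R = x - 1 := hR
  refine ⟨Units.oneSub (-R) (by rwa [norm_neg]), ?_⟩
  rw [Units.val_oneSub, sub_neg_eq_add, map_add, map_one, hR', add_sub_cancel]

/-! ### Fredholm operators -/

theorem finiteDimensional_ker {T R : H →L[ℂ] H} (h : π H R * π H T = 1) :
    FiniteDimensional ℂ T.ker := by
  have hK : IsCompactOperator (R * T - 1 : H →L[ℂ] H) := by
    rw [← π_eq_iff, map_mul, h, map_one]
  -- On the kernel of `T` the compact operator `R T - 1` acts as `-1`.
  have := ContinuousLinearMap.finite_dimensional_eigenspace hK (-1) (by simp)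
  refine Submodule.finiteDimensional_of_le
    (S₂ := Module.End.eigenspace (R * T - 1 : H →L[ℂ] H).toLinearMap (-1 : ℂ)) fun x hx => ?_
  have hx' : T x = 0 := hx
  rw [Module.End.mem_eigenspace_iff]
  simp [hx']

theorem isUnit_of_injective {T R : H →L[ℂ] H} (h : π H R * π H T = 1)
    (hT : Function.Injective T) (hT' : Function.Injective (star T : H →L[ℂ] H)) : IsUnit T := by
  rw [ContinuousLinearMap.isUnit_iff_bijective]
  obtain ⟨K, hK⟩ := exists_antilipschitz h hT
  refine ⟨hT, ?_⟩
  have hc : IsClosed (T.range : Set H) := (hK.isClosedEmbedding T.uniformContinuous).isClosed_range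
  have hd : T.rangeᗮ = ⊥ := by
    rw [ContinuousLinearMap.orthogonal_range]
    exact LinearMap.ker_eq_bot.2 hT'
  rw [← Submodule.topologicalClosure_eq_top_iff, hc.submodule_topologicalClosure_eq] at hd
  exact LinearMap.range_eq_top.1 hd

/-- A Fredholm operator of index zero is a compact perturbation of an invertible operator. -/
theorem mem_liftable_of_finrank_eq {T : H →L[ℂ] H} {x : (CalkinAlgebra H)ˣ} (hx : π H T = x)
    (hT : Module.finrank ℂ T.ker = Module.finrank ℂ (star T).ker) : x ∈ liftable H := by
  obtain ⟨R, hR⟩ := π_surjective (↑x⁻¹ : CalkinAlgebra H)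
  have hRT : π H R * π H T = 1 := by rw [hR, hx, Units.inv_mul]
  have hTR : π H (star R) * π H (star T) = 1 := by
    rw [π_star, π_star, ← star_mul, hR, hx, Units.mul_inv, star_one]
  have := finiteDimensional_ker hRT
  have := finiteDimensional_ker hTR
  let e : T.ker ≃ₗ[ℂ] (star T).ker := LinearEquiv.ofFinrankEq _ _ hT
  let e' : T.ker →L[ℂ] (star T).ker := LinearMap.toContinuousLinearMap e.toLinearMap
  -- `F` carries `ker T` isomorphically onto `ker T*` and vanishes on the orthogonal complement of
  -- `ker T`. It has finite rank, and its range is orthogonal to that of `T`, so `T + F` and its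
  -- adjoint are injective.
  let F : H →L[ℂ] H := (star T).ker.subtypeL ∘L e' ∘L T.ker.orthogonalProjectionOnto
  have hFmem : ∀ v, F v ∈ (star T).ker := fun v => (e' (T.ker.orthogonalProjectionOnto v)).2
  have := FiniteDimensional.proper ℂ T.ker
  have hF : IsCompactOperator F :=
    (isCompactOperator_of_locallyCompactSpace_dom T.ker.orthogonalProjectionOnto).clm_comp
      ((star T).ker.subtypeL ∘L e')
  have hV : π H (T + F) = x := by rw [map_add, π_eq_zero_iff.2 hF, add_zero, hx]
  have horth : ∀ v, ∀ w ∈ (star T).ker, inner ℂ (T v) w = 0 := fun v w hw => by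
    have hw' : (star T) w = 0 := hw
    rw [← ContinuousLinearMap.adjoint_inner_right, ← ContinuousLinearMap.star_eq_adjoint, hw',
      inner_zero_right]
  have hinj : Function.Injective (T + F) := by
    rw [injective_iff_map_eq_zero]
    intro v hv
    have hv' : T v + F v = 0 := hv
    have hFv : F v = 0 := by
      rw [← inner_self_eq_zero (𝕜 := ℂ)]
      have := horth v _ (hFmem v)
      rw [eq_neg_of_add_eq_zero_left hv', inner_neg_left, neg_eq_zero] at this
      exact this
    have hTv : v ∈ T.ker := by
      rw [hFv, add_zero] at hv'
      exact hv'
    have h1 : e (T.ker.orthogonalProjectionOnto v) = 0 := Subtype.ext hFv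
    rw [LinearEquiv.map_eq_zero_iff] at h1
    rw [← Submodule.starProjection_eq_self_iff.2 hTv, Submodule.starProjection_apply, h1]
    rfl
  have hinj' : Function.Injective (star (T + F) : H →L[ℂ] H) := by
    rw [injective_iff_map_eq_zero]
    intro w hw
    have hw' : ∀ v, inner ℂ ((T + F) v) w = 0 := fun v => by
      rw [← ContinuousLinearMap.adjoint_inner_right, ← ContinuousLinearMap.star_eq_adjoint, hw,
        inner_zero_right]
    have hker : ∀ u ∈ (star T).ker, inner ℂ u w = 0 := fun u hu => by
      have := hw' (e.symm ⟨u, hu⟩ : T.ker)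
      have h0 : T (e.symm ⟨u, hu⟩ : T.ker) = 0 := (e.symm ⟨u, hu⟩).2
      have h1 : F (e.symm ⟨u, hu⟩ : T.ker) = u := by
        simp [F, e']
      rwa [add_apply, h0, h1, zero_add] at this
    have hwk : w ∈ (star T).ker := by
      refine ext_inner_left ℂ fun v => ?_
      rw [inner_zero_right]
      change inner ℂ v ((star T) w) = 0
      rw [ContinuousLinearMap.star_eq_adjoint, ContinuousLinearMap.adjoint_inner_right]
      have := hw' v
      rwa [add_apply, inner_add_left, hker _ (hFmem v), add_zero] at this
    exact inner_self_eq_zero.1 (hker w hwk)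
  have hRV : π H R * π H (T + F) = 1 := by rw [hR, hV, Units.inv_mul]
  obtain ⟨V, hVu⟩ := isUnit_of_injective hRV hinj hinj'
  exact mem_liftable.2 ⟨V, by rw [hVu, hV]⟩

/-- The Fredholm alternative for compact perturbations of invertible operators. -/
theorem surjective_of_injective_of_mem_liftable {T : H →L[ℂ] H} {x : (CalkinAlgebra H)ˣ}
    (hx : π H T = x) (hxl : x ∈ liftable H) (hT : Function.Injective T) :
    Function.Surjective T := by
  obtain ⟨V, hV⟩ := mem_liftable.1 hxl
  have hK : IsCompactOperator (↑V⁻¹ * T - 1 : H →L[ℂ] H) := by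
    rw [← π_eq_iff, map_mul, hx, ← hV, ← map_mul, Units.inv_mul]
  have hVinj : Function.Bijective (↑V⁻¹ : H →L[ℂ] H) :=
    ContinuousLinearMap.isUnit_iff_bijective.1 (Units.isUnit _)
  -- An eigenvector of `V⁻¹ T - 1` for `-1` is a kernel vector of `T`; without one, `V⁻¹ T` is
  -- invertible.
  rcases hK.hasEigenvalue_or_mem_resolventSet (μ := -1) (by simp) with h | h
  · obtain ⟨v, hv⟩ := h.exists_hasEigenvector
    have h1 := hv.apply_eq_smul
    have h2 : (↑V⁻¹ : H →L[ℂ] H) (T v) = 0 := by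
      simpa using h1
    exact absurd (hT ((hVinj.1 (h2.trans (map_zero _).symm)).trans (map_zero T).symm)) hv.2
  · rw [spectrum.mem_resolventSet_iff] at h
    have h1 : IsUnit (↑V⁻¹ * T : H →L[ℂ] H) := by
      rw [← IsUnit.neg_iff]
      convert h using 1
      rw [map_neg, map_one]
      abel
    have h2 := (Units.isUnit_units_mul V⁻¹ T).1 h1
    exact (ContinuousLinearMap.isUnit_iff_bijective.1 h2).2

end Calkin

namespace Calkin

/-! ### The unilateral shift -/

section Shift

theorem nonempty_linearIsometryEquiv_lp (E : Type*) [NormedAddCommGroup E] [InnerProductSpace ℂ E]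
    [CompleteSpace E] [TopologicalSpace.SeparableSpace E] (hE : ¬ FiniteDimensional ℂ E) :
    Nonempty (E ≃ₗᵢ[ℂ] lp (fun _ : ℕ => ℂ) 2) := by
  obtain ⟨w, b, hb⟩ := exists_hilbertBasis ℂ E
  -- Distinct basis vectors are at distance at least 1, so the balls of radius `1 / 2` around them
  -- are disjoint, and separability makes the basis countable.
  have hdist : Pairwise fun i j : w => 1 ≤ dist (i : E) j := by
    intro i j hij
    have hi := b.orthonormal.1 i
    have hj := b.orthonormal.1 j
    have ho := b.orthonormal.2 hij
    simp only [hb] at hi hj ho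
    have h2 := norm_sub_mul_self (𝕜 := ℂ) (i : E) j
    rw [hi, hj, ho] at h2
    rw [dist_eq_norm]
    simp at h2
    nlinarith [norm_nonneg ((i : E) - j)]
  have hcount : Countable w := by
    refine Pairwise.countable_of_isOpen_disjoint (s := fun i : w => Metric.ball (i : E) (1 / 2))
      (fun i j hij => Metric.ball_disjoint_ball ?_) (fun _ => Metric.isOpen_ball)
      fun i => Metric.nonempty_ball.2 (by norm_num)
    norm_num
    exact hdist hij
  have hinf : Infinite w := by
    by_contra hfin
    rw [not_infinite_iff_finite] at hfin
    have := Fintype.ofFinite w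
    exact hE (Module.Finite.of_basis b.toOrthonormalBasis.toBasis)
  obtain ⟨e⟩ := nonempty_equiv_of_countable (α := ℕ) (β := w)
  exact ⟨(HilbertBasis.mk (b.orthonormal.comp e e.injective) (by
    rw [EquivLike.range_comp b e, b.dense_span])).repr⟩

end Shift
variable {H : Type*} [NormedAddCommGroup H] [InnerProductSpace ℂ H] [CompleteSpace H]

/-- A separable infinite-dimensional Hilbert space carries an isometry of corank one. -/
theorem exists_shift [TopologicalSpace.SeparableSpace H] (hH : ¬ FiniteDimensional ℂ H) :
    ∃ S : H →L[ℂ] H, star S * S = 1 ∧ Module.finrank ℂ (star S).ker = 1 := by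
  have : Nontrivial H := by
    by_contra h
    rw [not_nontrivial_iff_subsingleton] at h
    exact hH inferInstance
  obtain ⟨e, he⟩ := exists_ne (0 : H)
  -- The hyperplane `W` and `H` are both isometric to `ℓ²`. An isometry of `H` onto `W`, followed by
  -- the inclusion, has cokernel spanned by `e`.
  let W : Submodule ℂ H := (ℂ ∙ e)ᗮ
  have hW : ¬ FiniteDimensional ℂ W := fun h => by
    refine hH (Module.finite_def.2 ?_)
    rw [← Submodule.sup_orthogonal_of_hasOrthogonalProjection (K := ℂ ∙ e)]
    exact (Submodule.fg_span_singleton e).sup (Submodule.fg_iff_finiteDimensional _ |>.2 h)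
  have : CompleteSpace W := (Submodule.isClosed_orthogonal _).completeSpace_coe
  obtain ⟨f⟩ := nonempty_linearIsometryEquiv_lp H hH
  obtain ⟨g⟩ := nonempty_linearIsometryEquiv_lp W hW
  let i : H ≃ₗᵢ[ℂ] W := f.trans g.symm
  let S' : H →ₗᵢ[ℂ] H := W.subtypeₗᵢ.comp i.toLinearIsometry
  let S : H →L[ℂ] H := S'.toContinuousLinearMap
  have hr : S.range = W := by
    ext v
    constructor
    · rintro ⟨u, rfl⟩
      exact (i u).2
    · intro hv
      exact ⟨i.symm ⟨v, hv⟩, by simp [S, S']⟩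
  refine ⟨S, ?_, ?_⟩
  · rw [ContinuousLinearMap.star_eq_adjoint]
    exact (ContinuousLinearMap.norm_map_iff_adjoint_comp_self S).1 S'.norm_map
  · rw [ContinuousLinearMap.star_eq_adjoint, ← ContinuousLinearMap.orthogonal_range, hr,
      Submodule.orthogonal_orthogonal]
    exact finrank_span_singleton he

end Calkin

namespace Calkin

variable {H : Type*} [NormedAddCommGroup H] [InnerProductSpace ℂ H] [CompleteSpace H]

/-! ### The index modulo liftable units -/

variable {S : H →L[ℂ] H}

theorem star_pow_mul_pow (hS : star S * S = 1) (j : ℕ) : star S ^ j * S ^ j = 1 := by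
  induction j with
  | zero => simp
  | succ j ih =>
    rw [pow_succ, pow_succ', mul_assoc, ← mul_assoc (star S) S, hS, one_mul, ih]

theorem injective_pow (hS : star S * S = 1) (j : ℕ) : Function.Injective (S ^ j) :=
  Function.LeftInverse.injective (g := star S ^ j) fun v => by
    rw [← mul_apply_eq_comp, star_pow_mul_pow hS, one_apply_eq_self]

theorem ker_pow_mul (hS : star S * S = 1) (j : ℕ) (T : H →L[ℂ] H) : (S ^ j * T).ker = T.ker := by
  ext v
  exact (injective_pow hS j).eq_iff' (map_zero _)

/-- An isometry of finite corank is a unit of the Calkin algebra. -/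
theorem π_mul_star_eq_one (hS : star S * S = 1) [FiniteDimensional ℂ (star S).ker] :
    π H S * π H (star S) = 1 := by
  have hmem : ∀ v, (1 - S * star S : H →L[ℂ] H) v ∈ (star S).ker := fun v => by
    change (star S * (1 - S * star S) : H →L[ℂ] H) v = 0
    rw [mul_sub, ← mul_assoc, hS, mul_one, one_mul, sub_self, zero_apply]
  have := FiniteDimensional.proper ℂ (star S).ker
  have hc : IsCompactOperator (1 - S * star S : H →L[ℂ] H) :=
    (isCompactOperator_of_locallyCompactSpace_dom
      ((1 - S * star S : H →L[ℂ] H).codRestrict (star S).ker hmem)).clm_comp (star S).ker.subtypeL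
  rw [← map_mul, ← map_one (π H), eq_comm, π_eq_iff]
  exact hc

/-- The unit of the Calkin algebra given by an isometry of finite corank. -/
noncomputable def shiftUnit (hS : star S * S = 1) [FiniteDimensional ℂ (star S).ker] :
    (CalkinAlgebra H)ˣ where
  val := π H S
  inv := π H (star S)
  val_inv := π_mul_star_eq_one hS
  inv_val := by rw [← map_mul, hS, map_one]

/-- Rank-nullity for `S*`, which maps `ker (T S*)` onto `ker T` with one-dimensional kernel `ker
S*`. -/
theorem finrank_ker_mul_star (hS : star S * S = 1) (hS1 : Module.finrank ℂ (star S).ker = 1)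
    (T : H →L[ℂ] H) [FiniteDimensional ℂ (T * star S).ker] :
    Module.finrank ℂ (T * star S).ker = Module.finrank ℂ T.ker + 1 := by
  let f : (T * star S).ker →ₗ[ℂ] T.ker :=
    (star S).toLinearMap.restrict fun v (hv : v ∈ (T * star S).ker) => hv
  have hf : f.range = ⊤ := LinearMap.range_eq_top.2 fun v => by
    have hv : (star S) (S v) = v := by
      rw [← mul_apply_eq_comp, hS, one_apply_eq_self]
    refine ⟨⟨S v, ?_⟩, Subtype.ext hv⟩
    change T ((star S) (S v)) = 0
    rw [hv]
    exact v.2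
  have hle : (star S).ker ≤ (T * star S).ker := fun v hv => by
    have hv' : (star S) v = 0 := hv
    change T ((star S) v) = 0
    rw [hv', map_zero]
  have hk : f.ker = (star S).ker.comap (T * star S).ker.subtype := by
    ext v
    exact Subtype.ext_iff
  have := f.finrank_range_add_finrank_ker
  rw [hf, finrank_top, hk, (Submodule.comapSubtypeEquivOfLe hle).finrank_eq, hS1] at this
  exact this.symm

variable [FiniteDimensional ℂ (star S).ker]

theorem finrank_ker_mul_star_pow (hS : star S * S = 1)
    (hS1 : Module.finrank ℂ (star S).ker = 1) {T R : H →L[ℂ] H} (hRT : π H R * π H T = 1) (j : ℕ) :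
    Module.finrank ℂ (T * star S ^ j).ker = Module.finrank ℂ T.ker + j := by
  have hinv : ∀ j, π H (S ^ j * R) * π H (T * star S ^ j) = 1 := fun j => by
    rw [map_mul, map_mul, mul_assoc, ← mul_assoc (π H R), hRT, one_mul, map_pow, map_pow]
    have := (shiftUnit hS ^ j).mul_inv
    rwa [← inv_pow] at this
  induction j with
  | zero => rw [pow_zero, mul_one, add_zero]
  | succ j ih =>
    rw [pow_succ, ← mul_assoc]
    have := finiteDimensional_ker (hinv (j + 1))
    rw [pow_succ (star S), ← mul_assoc] at this
    rw [finrank_ker_mul_star hS hS1, ih, add_assoc]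

/-- Every unit of the Calkin algebra is, up to a power of the shift, liftable. -/
theorem exists_shift_mul_mem (hS : star S * S = 1) (hS1 : Module.finrank ℂ (star S).ker = 1)
    (x : (CalkinAlgebra H)ˣ) :
    (∃ j : ℕ, shiftUnit hS ^ j * x ∈ liftable H) ∨
      ∃ j : ℕ, x * (shiftUnit hS)⁻¹ ^ j ∈ liftable H := by
  obtain ⟨T, hT⟩ := π_surjective (x : CalkinAlgebra H)
  obtain ⟨R, hR⟩ := π_surjective (↑x⁻¹ : CalkinAlgebra H)
  have hRT : π H R * π H T = 1 := by rw [hR, hT, Units.inv_mul]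
  have hTR : π H (star R) * π H (star T) = 1 := by
    rw [π_star, π_star, ← star_mul, hR, hT, Units.mul_inv, star_one]
  -- Multiplying by `S ^ j` on the left keeps `ker T` and adds `j` to the dimension of the kernel of
  -- the adjoint; multiplying by `S* ^ j` on the right does the opposite. Choosing `j` as the
  -- difference of the two dimensions balances them.
  rcases le_total (Module.finrank ℂ (star T).ker) (Module.finrank ℂ T.ker) with h | h
  · obtain ⟨j, hj⟩ := Nat.exists_eq_add_of_le h
    refine .inl ⟨j, mem_liftable_of_finrank_eq (T := S ^ j * T) ?_ ?_⟩
    · rw [map_mul, map_pow, hT]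
      rfl
    · rw [ker_pow_mul hS, star_mul, star_pow, finrank_ker_mul_star_pow hS hS1 hTR, hj]
  · obtain ⟨j, hj⟩ := Nat.exists_eq_add_of_le h
    refine .inr ⟨j, mem_liftable_of_finrank_eq (T := T * star S ^ j) ?_ ?_⟩
    · rw [map_mul, map_pow, hT]
      rfl
    · rw [star_mul, star_pow, star_star, ker_pow_mul hS, finrank_ker_mul_star_pow hS hS1 hRT, hj]

/-- A liftable power of the injective `S` is surjective by the Fredholm alternative. For a positive
exponent this would force `ker S* = 0`. -/
theorem eq_zero_of_shift_pow_mem (hS : star S * S = 1)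
    (hS1 : Module.finrank ℂ (star S).ker = 1) {j : ℕ} (hj : shiftUnit hS ^ j ∈ liftable H) :
    j = 0 := by
  by_contra h0
  obtain ⟨i, rfl⟩ := Nat.exists_eq_succ_of_ne_zero h0
  have hsurj := surjective_of_injective_of_mem_liftable (T := S ^ (i + 1))
    (by rw [map_pow]; rfl) hj (injective_pow hS _)
  have hker : (star S).ker = ⊥ := by
    rw [LinearMap.ker_eq_bot']
    intro v hv
    obtain ⟨u, rfl⟩ := hsurj v
    have h1 : (star S ^ (i + 1)) ((S ^ (i + 1)) u) = 0 := by
      rw [pow_succ, mul_apply_eq_comp]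
      have hv' : (star S) ((S ^ (i + 1)) u) = 0 := hv
      rw [hv', map_zero]
    rw [← mul_apply_eq_comp, star_pow_mul_pow hS] at h1
    rw [show u = 0 from h1, map_zero]
  rw [hker, finrank_bot] at hS1
  exact zero_ne_one hS1

/-- If `V` lifts `t`, then `S V S* + (1 - S S*)` is invertible with inverse `S V⁻¹ S* + (1 - S S*)`,
and the summand `1 - S S*` is compact. -/
theorem shift_conj_mem (hS : star S * S = 1) {t : (CalkinAlgebra H)ˣ} (ht : t ∈ liftable H) :
    shiftUnit hS * t * (shiftUnit hS)⁻¹ ∈ liftable H := by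
  obtain ⟨V, hV⟩ := mem_liftable.1 ht
  have hP : star S * (1 - S * star S) = 0 := by
    rw [mul_sub, ← mul_assoc, hS, mul_one, one_mul, sub_self]
  have hP' : (1 - S * star S) * S = 0 := by
    rw [sub_mul, mul_assoc, hS, mul_one, one_mul, sub_self]
  have hPP : (1 - S * star S) * (1 - S * star S) = 1 - S * star S := by
    rw [sub_mul, mul_assoc, hP, mul_zero, sub_zero, one_mul]
  have key : ∀ A B : H →L[ℂ] H, A * B = 1 →
      (S * A * star S + (1 - S * star S)) * (S * B * star S + (1 - S * star S)) = 1 := by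
    intro A B hAB
    have h1 : S * A * star S * (S * B * star S) = S * star S := by
      rw [show S * A * star S * (S * B * star S) = S * (A * (star S * S) * B) * star S by
        noncomm_ring, hS, mul_one, hAB, mul_one]
    rw [add_mul, mul_add, mul_add, h1, hPP, mul_assoc (S * A), hP, mul_assoc S B, ← mul_assoc _ S,
      hP']
    simp
  refine mem_liftable.2 ⟨⟨_, _, key _ _ V.mul_inv, key _ _ V.inv_mul⟩, ?_⟩
  change π H (S * V * star S + (1 - S * star S)) = π H S * t * π H (star S)
  simp only [map_add, map_sub, map_mul, map_one, hV, π_mul_star_eq_one hS, sub_self, add_zero]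

/-- It suffices that `s` normalizes the subgroup, since every unit is liftable up to a power of `s`.
One inclusion is `shift_conj_mem`. For the converse, `h` is liftable up to some `s ^ j`; conjugation
by `s` then shows that `s ^ j` is liftable, so `j = 0`. -/
theorem liftable_normal (hS : star S * S = 1) (hS1 : Module.finrank ℂ (star S).ker = 1) :
    (liftable H).Normal := by
  have hs : shiftUnit hS ∈ Subgroup.normalizer (liftable H : Set (CalkinAlgebra H)ˣ) := by
    rw [Subgroup.mem_normalizer_iff]
    refine fun h => ⟨shift_conj_mem hS, fun hh => ?_⟩
    rcases exists_shift_mul_mem hS hS1 h with ⟨j, hj⟩ | ⟨j, hj⟩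
    · have h1 := shift_conj_mem hS hj
      rw [show shiftUnit hS * (shiftUnit hS ^ j * h) * (shiftUnit hS)⁻¹ =
        shiftUnit hS ^ j * (shiftUnit hS * h * (shiftUnit hS)⁻¹) by
          rw [← mul_assoc, ← pow_succ', pow_succ]; group, Subgroup.mul_mem_cancel_right _ hh] at h1
      rw [eq_zero_of_shift_pow_mem hS hS1 h1, pow_zero, one_mul] at hj
      exact hj
    · have h1 := shift_conj_mem hS hj
      rw [show shiftUnit hS * (h * (shiftUnit hS)⁻¹ ^ j) * (shiftUnit hS)⁻¹ =
        shiftUnit hS * h * (shiftUnit hS)⁻¹ * (shiftUnit hS ^ j)⁻¹ by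
          group, Subgroup.mul_mem_cancel_left _ hh, inv_mem_iff] at h1
      rw [eq_zero_of_shift_pow_mem hS hS1 h1, pow_zero, mul_one] at hj
      exact hj
  refine Subgroup.normalizer_eq_top_iff.1 (top_le_iff.1 fun x _ => ?_)
  rcases exists_shift_mul_mem hS hS1 x with ⟨j, hj⟩ | ⟨j, hj⟩
  · exact (Subgroup.mul_mem_cancel_left _ (pow_mem hs j)).1 (Subgroup.le_normalizer hj)
  · exact (Subgroup.mul_mem_cancel_right _ (pow_mem (inv_mem hs) j)).1 (Subgroup.le_normalizer hj)

theorem exists_mk_eq_zpow (hS : star S * S = 1) (hS1 : Module.finrank ℂ (star S).ker = 1)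
    [(liftable H).Normal] (x : (CalkinAlgebra H)ˣ) :
    ∃ j : ℤ, (x : (CalkinAlgebra H)ˣ ⧸ liftable H) = (shiftUnit hS : _ ⧸ liftable H) ^ j := by
  rcases exists_shift_mul_mem hS hS1 x with ⟨j, hj⟩ | ⟨j, hj⟩
  · refine ⟨-j, ?_⟩
    rw [← QuotientGroup.eq_one_iff, QuotientGroup.mk_mul, QuotientGroup.mk_pow] at hj
    rw [zpow_neg, zpow_natCast]
    exact eq_inv_of_mul_eq_one_right hj
  · refine ⟨j, ?_⟩
    rw [← QuotientGroup.eq_one_iff, QuotientGroup.mk_mul, QuotientGroup.mk_pow,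
      QuotientGroup.mk_inv, inv_pow] at hj
    rw [zpow_natCast]
    exact mul_inv_eq_one.1 hj

theorem zpow_shift_injective (hS : star S * S = 1) (hS1 : Module.finrank ℂ (star S).ker = 1)
    [(liftable H).Normal] :
    Function.Injective fun j : ℤ => (shiftUnit hS : (CalkinAlgebra H)ˣ ⧸ liftable H) ^ j := by
  rw [injective_zpow_iff_not_isOfFinOrder, isOfFinOrder_iff_pow_eq_one]
  rintro ⟨j, hj, h⟩
  rw [← QuotientGroup.mk_pow, QuotientGroup.eq_one_iff] at h
  exact hj.ne' (eq_zero_of_shift_pow_mem hS hS1 h)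

/-- The index is the exponent of `s` in the cyclic quotient, so it is additive by construction. Its
sign is opposite to `dim ker - dim coker`. -/
theorem exists_index (hS : star S * S = 1) (hS1 : Module.finrank ℂ (star S).ker = 1) :
    ∃ ind : (CalkinAlgebra H)ˣ →* Multiplicative ℤ,
      ind.ker = liftable H ∧ ind (shiftUnit hS) = Multiplicative.ofAdd 1 := by
  have := liftable_normal hS hS1
  have hinj := zpow_shift_injective hS hS1
  choose j hj using exists_mk_eq_zpow hS hS1
  have h1 : j 1 = 0 := hinj (by simp [← hj])
  refine ⟨⟨⟨fun x => .ofAdd (j x), congrArg _ h1⟩, fun x y => ?_⟩, ?_, ?_⟩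
  · refine congrArg Multiplicative.ofAdd (a₂ := j x + j y) (hinj ?_)
    simp only [zpow_add, ← hj, QuotientGroup.mk_mul]
  · ext x
    rw [MonoidHom.mem_ker, ← QuotientGroup.eq_one_iff]
    change Multiplicative.ofAdd (j x) = 1 ↔ _
    rw [ofAdd_eq_one]
    exact ⟨fun h => by rw [hj, h, zpow_zero], fun h => hinj (by simpa [← hj] using h)⟩
  · exact congrArg Multiplicative.ofAdd (hinj (by simp [← hj]))

end Calkin

namespace Calkin

/-! ### Roots of unitary operators -/

/-- Block-diagonal multiplication along the idempotent `q`. -/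
theorem splitting_mul {R : Type*} [Ring R] {q A B A' B' : R} (hq : q * q = q)
    (hA : q * A' = A' * q) (hB : q * B' = B' * q) :
    (A * (1 - q) + B * q) * (A' * (1 - q) + B' * q) = A * A' * (1 - q) + B * B' * q := by
  have h1 : q * (A' * (1 - q)) = 0 := by
    rw [← mul_assoc, hA, mul_assoc, mul_sub, hq, mul_one, sub_self, mul_zero]
  have h2 : q * (B' * q) = B' * q := by rw [← mul_assoc, hB, mul_assoc, hq]
  have h3 : (1 - q) * (A' * (1 - q)) = A' * (1 - q) := by rw [sub_mul, h1, one_mul, sub_zero]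
  have h4 : (1 - q) * (B' * q) = 0 := by rw [sub_mul, h2, one_mul, sub_self]
  rw [add_mul, mul_add, mul_add, mul_assoc A, mul_assoc A, h3, h4, mul_assoc B, mul_assoc B, h1, h2]
  simp [mul_assoc]

theorem splitting_pow {R : Type*} [Ring R] {q A B : R} (hq : q * q = q)
    (hA : q * A = A * q) (hB : q * B = B * q) (k : ℕ) :
    (A * (1 - q) + B * q) ^ k = A ^ k * (1 - q) + B ^ k * q := by
  induction k with
  | zero => simp
  | succ k ih => rw [pow_succ, ih, splitting_mul hq hA hB, pow_succ, pow_succ]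

variable {H : Type*} [NormedAddCommGroup H] [InnerProductSpace ℂ H] [CompleteSpace H]

/-- The projection onto the kernel of a self-adjoint operator. -/
theorem exists_kernel_projection {b : H →L[ℂ] H} (hb : star b = b) :
    ∃ q : H →L[ℂ] H, star q = q ∧ q * q = q ∧ b * q = 0 ∧ (∀ C, b * C = 0 → q * C = C) ∧
      ∀ C, b * C = C * b → q * C = C * q := by
  have hcl : IsClosed (b.ker : Set H) := b.isClosed_ker
  have : CompleteSpace b.ker := hcl.completeSpace_coe
  let q := b.ker.starProjection
  have hq : star q = q := (isSelfAdjoint_starProjection b.ker).star_eq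
  have hqq : q * q = q := b.ker.isIdempotentElem_starProjection
  have hbq : b * q = 0 := by
    ext v
    exact b.ker.starProjection_apply_mem v
  have hfix : ∀ C, b * C = 0 → q * C = C := fun C hC => by
    ext v
    exact Submodule.starProjection_eq_self_iff.2 (show C v ∈ b.ker from DFunLike.congr_fun hC v)
  refine ⟨q, hq, hqq, hbq, hfix, fun C hC => ?_⟩
  -- Both `C` and its adjoint preserve `ker b`, so `q C q` equals `C q` and also `q C`.
  have h1 : q * (C * q) = C * q := hfix _ (by rw [← mul_assoc, hC, mul_assoc, hbq, mul_zero])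
  have hC' : b * star C = star C * b := by
    have := congrArg star hC
    rwa [star_mul, star_mul, hb, eq_comm] at this
  have h2 : q * (star C * q) = star C * q :=
    hfix _ (by rw [← mul_assoc, hC', mul_assoc, hbq, mul_zero])
  have h3 := congrArg star h2
  simp only [star_mul, star_star, hq] at h3
  rw [← h3, mul_assoc, h1]

theorem exp_arccos_re {z : ℂ} (hz : ‖z‖ = 1) :
    Complex.exp (Real.arccos z.re * Complex.I) = z.re + |z.im| * Complex.I := by
  have hre := abs_le.1 (hz ▸ Complex.abs_re_le_norm z)
  have him : √(1 - z.re ^ 2) = |z.im| := by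
    rw [← Real.sqrt_sq_eq_abs]
    have := Complex.sq_norm z
    rw [Complex.normSq_apply, hz] at this
    congr 1
    linarith
  rw [Complex.exp_mul_I, ← Complex.ofReal_cos, ← Complex.ofReal_sin, Real.cos_arccos hre.1 hre.2,
    Real.sin_arccos, him]

/-- The circle has no continuous `k`-th root, so the root is built from two pieces. The projection
`q` onto `ker m(U)` plays the role of the spectral projection of the closed lower semicircle; `r 1`
is a root on the upper semicircle and `r (-1)` on the lower one. -/
theorem exists_unitary_root {U : H →L[ℂ] H} (hU : U ∈ unitary (H →L[ℂ] H)) {k : ℕ} (hk : k ≠ 0) :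
    ∃ W ∈ unitary (H →L[ℂ] H), W ^ k = U := by
  have hn : IsStarNormal U := ⟨by
    rw [Commute, SemiconjBy, Unitary.star_mul_self_of_mem hU, Unitary.mul_star_self_of_mem hU]⟩
  have hsp : ∀ z ∈ spectrum ℂ U, ‖z‖ = 1 := fun z hz => by
    simpa using spectrum.subset_circle_of_unitary hU hz
  let m : ℂ → ℂ := fun z => (max z.im 0 : ℝ)
  let r (σ : ℝ) : ℂ → ℂ := fun z => Complex.exp ((σ * Real.arccos z.re / k : ℝ) * Complex.I)
  have hm : Continuous m := by fun_prop
  have hr : ∀ σ, Continuous (r σ) := fun σ => by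
    have := Real.continuous_arccos
    fun_prop
  have hrk : ∀ σ z, r σ z ^ k = Complex.exp ((σ * Real.arccos z.re : ℝ) * Complex.I) := by
    intro σ z
    rw [← Complex.exp_nat_mul]
    congr 1
    push_cast
    field_simp
  have hrs : ∀ σ, star (cfc (r σ) U) * cfc (r σ) U = 1 := fun σ => by
    rw [← cfc_star, ← cfc_mul (fun z => star (r σ z)) (r σ) U (by fun_prop) (by fun_prop),
      ← cfc_const_one ℂ U]
    congr 1
    ext z
    rw [Complex.star_def, mul_comm, Complex.mul_conj, Complex.normSq_eq_norm_sq,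
      Complex.norm_exp_ofReal_mul_I]
    simp
  have hcomm : ∀ f g : ℂ → ℂ, cfc f U * cfc g U = cfc g U * cfc f U := fun f g =>
    (cfc_commute_cfc f g U).eq
  have hrs' : ∀ σ, cfc (r σ) U * star (cfc (r σ) U) = 1 := fun σ => by
    rw [← cfc_star, hcomm, cfc_star, hrs]
  have hb : star (cfc m U) = cfc m U := by
    rw [← cfc_star]
    congr 1
    ext z
    exact Complex.conj_ofReal _
  obtain ⟨q, hq, hqq, hbq, hfix, hqc⟩ := exists_kernel_projection hb
  have hqr : ∀ f : ℂ → ℂ, q * cfc f U = cfc f U * q := fun f => hqc _ (hcomm m f)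
  have hplus : cfc (r 1) U ^ k * (1 - q) = U * (1 - q) := by
    have h1 : cfc (r 1) U ^ k - U = cfc (fun z => r 1 z ^ k - z) U := by
      rw [cfc_sub (fun z => r 1 z ^ k) (fun z => z) U (by fun_prop) (by fun_prop), cfc_pow (r 1) k U
        (by fun_prop), cfc_id' ℂ U]
    have h2 : cfc m U * cfc (fun z => r 1 z ^ k - z) U = 0 := by
      rw [← cfc_mul m (fun z => r 1 z ^ k - z) U (by fun_prop) (by fun_prop), ← cfc_zero ℂ U]
      refine cfc_congr fun z hz => ?_
      simp only [hrk, one_mul, exp_arccos_re (hsp z hz), Pi.zero_apply, m]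
      rcases le_total z.im 0 with h | h
      · simp [max_eq_right h]
      · rw [abs_of_nonneg h, Complex.re_add_im, sub_self, mul_zero]
    rw [← sub_eq_zero, ← sub_mul, h1, mul_sub, mul_one, ← hqr, hfix _ h2, sub_self]
  have hminus : cfc (r (-1)) U ^ k * q = U * q := by
    have h1 : cfc (r (-1)) U ^ k - U = cfc (fun z => r (-1) z ^ k - z) U := by
      rw [cfc_sub (fun z => r (-1) z ^ k) (fun z => z) U (by fun_prop) (by fun_prop),
        cfc_pow (r (-1)) k U (by fun_prop), cfc_id' ℂ U]
    -- On the circle `r (-1) z ^ k` is the conjugate of `z` above the real axis and `z` itself below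
    -- it, so the error is a multiple of `m`, and `m(U) q = 0`.
    have h2 : cfc (fun z => r (-1) z ^ k - z) U = cfc (fun z => (-2 * Complex.I) * m z) U := by
      refine cfc_congr fun z hz => ?_
      have h3 : Complex.exp ((-1 * Real.arccos z.re : ℝ) * Complex.I)
          = z.re - |z.im| * Complex.I := by
        have := congrArg (starRingEnd ℂ) (exp_arccos_re (hsp z hz))
        rw [← Complex.exp_conj] at this
        simp only [map_mul, map_add, Complex.conj_ofReal, Complex.conj_I] at this
        convert this using 1
        · congr 1
          push_cast
          ring
        · ring
      simp only [hrk, h3, m]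
      rcases le_total z.im 0 with h | h
      · rw [max_eq_right h, abs_of_nonpos h]
        apply Complex.ext <;> simp
      · rw [max_eq_left h, abs_of_nonneg h]
        apply Complex.ext <;> simp
        ring
    rw [← sub_eq_zero, ← sub_mul, h1, h2, cfc_const_mul _ m U, smul_mul_assoc, hbq, smul_zero]
  have hWs : star (cfc (r 1) U * (1 - q) + cfc (r (-1)) U * q)
      = star (cfc (r 1) U) * (1 - q) + star (cfc (r (-1)) U) * q := by
    rw [star_add, star_mul, star_mul, star_sub, star_one, hq, ← cfc_star, ← cfc_star, hqr, sub_mul,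
      mul_sub, hqr, one_mul, mul_one]
  refine ⟨cfc (r 1) U * (1 - q) + cfc (r (-1)) U * q, Unitary.mem_iff.2 ⟨?_, ?_⟩, ?_⟩
  · rw [hWs, splitting_mul hqq (hqr _) (hqr _), hrs, hrs, one_mul, one_mul, sub_add_cancel]
  · rw [hWs, splitting_mul hqq (by rw [← cfc_star, hqr]) (by rw [← cfc_star, hqr]), hrs', hrs',
      one_mul, one_mul, sub_add_cancel]
  · rw [splitting_pow hqq (hqr _) (hqr _), hplus, hminus, ← mul_add, sub_add_cancel, mul_one]

theorem exists_positive_sqrt (V : (H →L[ℂ] H)ˣ) :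
    ∃ A : (H →L[ℂ] H)ˣ, star A = A ∧ A * A = star V * V ∧ IsUnit (A + 1 : H →L[ℂ] H) := by
  have h0 : 0 ≤ star (V : H →L[ℂ] H) * V := star_mul_self_nonneg _
  obtain ⟨A, hA0, hAA⟩ : ∃ A : H →L[ℂ] H, 0 ≤ A ∧ A * A = star (V : H →L[ℂ] H) * V :=
    ⟨_, CFC.sqrt_nonneg _, CFC.sqrt_mul_sqrt_self _ h0⟩
  have hAu : IsUnit A := by
    rw [← isUnit_pow_iff two_ne_zero, sq, hAA]
    exact V.isUnit.star.mul V.isUnit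
  obtain ⟨A, rfl⟩ := hAu
  refine ⟨A, Units.ext (IsSelfAdjoint.of_nonneg hA0).star_eq, Units.ext hAA, ?_⟩
  have h1 : (-1 : ℝ) ∉ spectrum ℝ (A : H →L[ℂ] H) := fun h => by
    linarith [spectrum_nonneg_of_nonneg hA0 h]
  rw [spectrum.notMem_iff, ← IsUnit.neg_iff] at h1
  convert h1 using 1
  rw [map_neg, map_one]
  abel

/-- A unitary of the Calkin algebra that lifts to an invertible operator lifts to a unitary. -/
theorem exists_unitary_lift {V : (H →L[ℂ] H)ˣ} (hV : star (π H V) * π H V = 1) :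
    ∃ U ∈ unitary (H →L[ℂ] H), π H U = π H V := by
  obtain ⟨A, hAs, hAA, hA1⟩ := exists_positive_sqrt V
  have hπAA : π H A * π H A = 1 := by
    rw [← map_mul, ← Units.val_mul, hAA, Units.val_mul, map_mul, Units.coe_star, π_star, hV]
  -- `π A` squares to 1 and `π A + 1` is invertible, so `π A = 1`. Hence the unitary factor `V A⁻¹`
  -- of the polar decomposition has the same image as `V`.
  have hπA : π H A = 1 := by
    have h1 : π H (A + 1) * (π H A - 1) = 0 := by
      rw [map_add, map_one, mul_sub, add_mul, hπAA, one_mul, mul_one, add_comm, sub_self]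
    exact sub_eq_zero.1 ((hA1.map (π H)).mul_right_eq_zero.1 h1)
  have hπA' : π H ↑A⁻¹ = 1 := by
    have h1 : π H (A * ↑A⁻¹) = 1 := by rw [Units.mul_inv, map_one]
    rwa [map_mul, hπA, one_mul] at h1
  have hU : star (V * A⁻¹) * (V * A⁻¹) = 1 := by
    rw [star_mul, star_inv, hAs, mul_assoc, ← mul_assoc (star V), ← hAA, mul_assoc A, mul_inv_cancel,
      mul_one, inv_mul_cancel]
  refine ⟨↑(V * A⁻¹), Unitary.mem_iff.2 ⟨?_, ?_⟩, by rw [Units.val_mul, map_mul, hπA', mul_one]⟩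
  · rw [← Units.coe_star, ← Units.val_mul, hU, Units.val_one]
  · rw [← Units.coe_star, ← Units.val_mul, mul_eq_one_comm.1 hU, Units.val_one]

end Calkin

/-! ### Supernatural numbers -/

namespace Supernatural

theorem divides_of_dvd {n : Supernatural} {k m : ℕ+} (h : (k : ℕ) ∣ m)
    (hm : (ofPNat m).Divides n) : (ofPNat k).Divides n := fun p =>
  le_trans (Nat.cast_le.2 (((Nat.factorization_le_iff_dvd k.ne_zero m.ne_zero).2 h) p)) (hm p)

theorem lcm_divides {n : Supernatural} {k m : ℕ+} (hk : (ofPNat k).Divides n)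
    (hm : (ofPNat m).Divides n) : (ofPNat (k.lcm m)).Divides n := fun p => by
  rw [ofPNat, PNat.lcm_coe, Nat.factorization_lcm k.ne_zero m.ne_zero, Finsupp.sup_apply]
  rcases max_choice ((k : ℕ).factorization p) ((m : ℕ).factorization p) with h | h
  · exact (congrArg Nat.cast h).trans_le (hk p)
  · exact (congrArg Nat.cast h).trans_le (hm p)

/-- Let `m` be the largest natural divisor. If its exponent at some prime `p` were below that of
`n`, then `m p` would be a larger divisor. -/
theorem exists_eq_ofPNat_of_bounded {n : Supernatural} {N : ℕ}
    (h : ∀ k : ℕ+, (ofPNat k).Divides n → (k : ℕ) ≤ N) : ∃ m : ℕ+, n = ofPNat m := by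
  have h1 : (ofPNat 1).Divides n := fun p => by simp [ofPNat]
  obtain ⟨m, hm, hmax⟩ : ∃ m : ℕ+, (ofPNat m).Divides n ∧
      ∀ k : ℕ+, (ofPNat k).Divides n → k ≤ m := by
    have hfin : {k : ℕ+ | (ofPNat k).Divides n}.Finite :=
      (Set.finite_Iic (⟨N + 1, N.succ_pos⟩ : ℕ+)).subset fun k hk =>
        PNat.coe_le_coe _ _ |>.1 ((h k hk).trans N.le_succ)
    obtain ⟨m, hm, hmax⟩ := hfin.exists_maximal ⟨1, h1⟩
    exact ⟨m, hm, fun k hk => (le_total k m).elim id (hmax hk)⟩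
  refine ⟨m, funext fun p => le_antisymm ?_ (hm p)⟩
  by_contra hlt
  rw [not_le] at hlt
  let q : ℕ+ := ⟨p, p.2.pos⟩
  have hmq : (ofPNat (m * q)).Divides n := fun r => by
    rw [ofPNat, PNat.mul_coe, Nat.factorization_mul m.ne_zero q.ne_zero, Finsupp.add_apply,
      PNat.mk_coe, p.2.factorization]
    by_cases hr : r = p
    · subst hr
      rw [Finsupp.single_eq_same, Nat.cast_add, Nat.cast_one]
      exact Order.add_one_le_of_lt hlt
    · rw [Finsupp.single_eq_of_ne (fun h => hr (Subtype.ext h)), add_zero]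
      exact hm r
  have h2 : (m * q : ℕ) ≤ m := hmax _ hmq
  have h3 : 2 ≤ (q : ℕ) := p.2.two_le
  nlinarith [m.pos]

theorem exists_not_divides {n : Supernatural} (hn : n ≠ fun _ => ⊤) :
    ∃ k : ℕ+, ¬ (ofPNat k).Divides n := by
  obtain ⟨p, hp⟩ := Function.ne_iff.1 hn
  obtain ⟨e, he⟩ := ENat.ne_top_iff_exists.1 hp
  refine ⟨⟨p ^ (e + 1), pow_pos p.2.pos _⟩, fun h => ?_⟩
  have h1 := h p
  simp only [ofPNat] at h1
  rw [PNat.mk_coe, p.2.factorization_pow, Finsupp.single_eq_same, ← he, Nat.cast_le] at h1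
  omega

end Supernatural

/-! ### The conditions of `rootType` are given by formulas -/

section Formula

variable {A : Type*} [NormedRing A]

theorem norm_pow_sub_pow_le [NormOneClass A] {y z : A} (hy : ‖y‖ ≤ 1) (hz : ‖z‖ ≤ 1) (k : ℕ) :
    ‖y ^ k - z ^ k‖ ≤ k * ‖y - z‖ := by
  induction k with
  | zero => simp
  | succ k ih =>
    have h1 : y ^ (k + 1) - z ^ (k + 1) = y ^ k * (y - z) + (y ^ k - z ^ k) * z := by
      rw [pow_succ, pow_succ]
      noncomm_ring
    have h2 : ‖y ^ k‖ ≤ 1 := (norm_pow_le y k).trans (pow_le_one₀ (norm_nonneg y) hy)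
    calc ‖y ^ (k + 1) - z ^ (k + 1)‖ ≤ ‖y ^ k‖ * ‖y - z‖ + ‖y ^ k - z ^ k‖ * ‖z‖ := by
          rw [h1]
          exact (norm_add_le _ _).trans (add_le_add (norm_mul_le _ _) (norm_mul_le _ _))
      _ ≤ 1 * ‖y - z‖ + k * ‖y - z‖ * 1 := by gcongr
      _ = (k + 1 : ℕ) * ‖y - z‖ := by push_cast; ring

/-- An infimum over the unit sphere as an infimum over the unit ball. -/
theorem iInf_sphere_eq_iInf_closedBall [NormOneClass A] [NormedAlgebra ℂ A] (x : A) (k : ℕ) :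
    ⨅ y : Metric.sphere (0 : A) 1, ‖(y : A) ^ k - x‖ =
      ⨅ y : Metric.closedBall (0 : A) (1 : ℕ), (‖(y : A) ^ k - x‖ + k * (1 - ‖(y : A)‖)) := by
  have : Nonempty (Metric.sphere (0 : A) 1) := ⟨⟨1, by simp⟩⟩
  have : Nonempty (Metric.closedBall (0 : A) (1 : ℕ)) := ⟨⟨0, by simp⟩⟩
  have hball : ∀ y : Metric.closedBall (0 : A) (1 : ℕ), ‖(y : A)‖ ≤ 1 := fun y => by
    simpa using y.2
  have hsphere : ∀ y : Metric.sphere (0 : A) 1, ‖(y : A)‖ = 1 := fun y => by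
    simp
  refine le_antisymm (le_ciInf fun y => ?_) (le_ciInf fun y => ?_)
  · obtain ⟨z, hz, hzy⟩ : ∃ z : A, ‖z‖ = 1 ∧ ‖z - y‖ ≤ 1 - ‖(y : A)‖ := by
      by_cases h0 : (y : A) = 0
      · exact ⟨1, norm_one, by simp [h0]⟩
      · have hpos : 0 < ‖(y : A)‖ := norm_pos_iff.2 h0
        refine ⟨((‖(y : A)‖⁻¹ : ℝ) : ℂ) • (y : A), by simp [norm_smul, hpos.ne'], ?_⟩
        have h1 : ((‖(y : A)‖⁻¹ : ℝ) : ℂ) • (y : A) - y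
            = ((‖(y : A)‖⁻¹ - 1 : ℝ) : ℂ) • (y : A) := by
          push_cast
          rw [sub_smul, one_smul]
        have h2 : 0 ≤ ‖(y : A)‖⁻¹ - 1 := sub_nonneg.2 ((one_le_inv₀ hpos).2 (hball y))
        rw [h1, norm_smul, Complex.norm_real, Real.norm_of_nonneg h2, sub_mul,
          inv_mul_cancel₀ hpos.ne', one_mul]
    refine ciInf_le_of_le ⟨0, ?_⟩ (⟨z, by simpa using hz⟩ : Metric.sphere (0 : A) 1) ?_
    · rintro _ ⟨y, rfl⟩
      exact norm_nonneg _
    · have h3 := norm_pow_sub_pow_le hz.le (hball y) k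
      have h4 := norm_sub_le_norm_sub_add_norm_sub (z ^ k) ((y : A) ^ k) x
      have h5 : (k : ℝ) * ‖z - y‖ ≤ k * (1 - ‖(y : A)‖) := by gcongr
      change ‖z ^ k - x‖ ≤ _
      linarith
  · refine ciInf_le_of_le ⟨0, ?_⟩
      (⟨y, by simp [hsphere y]⟩ : Metric.closedBall (0 : A) (1 : ℕ)) ?_
    · rintro _ ⟨y, rfl⟩
      exact add_nonneg (norm_nonneg _) (mul_nonneg k.cast_nonneg (sub_nonneg.2 (hball y)))
    · simp [hsphere y]

/-- The least common multiple of the finitely many exponents of root conditions in `S` still divides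
`n`. -/
theorem exists_common_divisor {n : Supernatural} {S : Set (Condition A)} (hS : S.Finite) :
    ∃ m : ℕ+, (Supernatural.ofPNat m).Divides n ∧ ∀ c ∈ S,
      (∃ k : ℕ+, (Supernatural.ofPNat k).Divides n ∧
        c = ⟨fun x => ‖x k ^ (k : ℕ) - x 0‖, {0}⟩) →
      ∃ k : ℕ+, (k : ℕ) ∣ m ∧ c = ⟨fun x => ‖x k ^ (k : ℕ) - x 0‖, {0}⟩ := by
  induction S, hS using Set.Finite.induction_on with
  | empty => exact ⟨1, fun p => by simp [Supernatural.ofPNat], by simp⟩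
  | @insert c S _ _ ih =>
    obtain ⟨m, hm, hmS⟩ := ih
    by_cases hc : ∃ k : ℕ+, (Supernatural.ofPNat k).Divides n ∧
        c = ⟨fun x => ‖x k ^ (k : ℕ) - x 0‖, {0}⟩
    · obtain ⟨k, hk, hck⟩ := hc
      refine ⟨k.lcm m, Supernatural.lcm_divides hk hm, ?_⟩
      rintro c' (rfl | hc') h
      · exact ⟨k, PNat.lcm_coe k m ▸ Nat.dvd_lcm_left _ _, hck⟩
      · obtain ⟨k', hk', hck'⟩ := hmS c' hc' h
        exact ⟨k', PNat.lcm_coe k m ▸ hk'.trans (Nat.dvd_lcm_right _ _), hck'⟩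
    · refine ⟨m, hm, ?_⟩
      rintro c' (rfl | hc') h
      · exact absurd h hc
      · exact hmS c' hc' h

variable [StarRing A]

theorem IsStarPolynomial.pow {P : (ℕ → A) → A} (hP : IsStarPolynomial A P) (k : ℕ) :
    IsStarPolynomial A fun x => P x ^ k := by
  induction k with
  | zero =>
    simp only [pow_zero]
    exact .const 1
  | succ k ih =>
    simp only [pow_succ]
    exact ih.mul hP

theorem IsStarPolynomial.sub {P Q : (ℕ → A) → A} (hP : IsStarPolynomial A P)
    (hQ : IsStarPolynomial A Q) : IsStarPolynomial A fun x => P x - Q x := by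
  have h := hP.add ((IsStarPolynomial.const (-1)).mul hQ)
  simpa only [neg_one_mul, ← sub_eq_add_neg] using h

theorem isFormula_iInf_sphere [NormOneClass A] [NormedAlgebra ℂ A] (k : ℕ) :
    IsFormula A fun x => ⨅ y : Metric.sphere (0 : A) 1, ‖(y : A) ^ k - x 0‖ := by
  have hF : Continuous fun v : Fin 2 → ℝ => v 0 + k * (1 - v 1) := by fun_prop
  have hφ : ∀ i, IsFormula A ((![fun x => ‖x 1 ^ k - x 0‖, fun x => ‖x 1‖] :
      Fin 2 → (ℕ → A) → ℝ) i) := by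
    rw [Fin.forall_fin_two]
    exact ⟨.norm (((IsStarPolynomial.var 1).pow k).sub (.var 0)), .norm (.var 1)⟩
  -- The bound variable is `x 1`, so `x 0` stays free.
  have h := (IsFormula.connective hF hφ).iInf 1 1
  convert h using 2 with x
  simpa using iInf_sphere_eq_iInf_closedBall (x 0) k

theorem isCountableType_rootType [NormOneClass A] [NormedAlgebra ℂ A] (n : Supernatural) :
    IsCountableType (rootType A n) := by
  refine ⟨((Set.to_countable _).union ?_).union ?_, ?_⟩
  · exact (Set.countable_range fun k : ℕ+ =>
      (⟨fun x => ‖x k ^ (k : ℕ) - x 0‖, {0}⟩ : Condition A)).mono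
        (by rintro c ⟨k, -, rfl⟩; exact ⟨k, rfl⟩)
  · exact (Set.countable_range fun k : ℕ+ =>
      (⟨fun x => ⨅ y : Metric.sphere (0 : A) 1, ‖(y : A) ^ (k : ℕ) - x 0‖, Set.Icc 1 2⟩ :
        Condition A)).mono (by rintro c ⟨k, -, rfl⟩; exact ⟨k, rfl⟩)
  · rintro c (((rfl | rfl) | ⟨k, -, rfl⟩) | ⟨k, -, rfl⟩)
    · exact ⟨.norm (((IsStarPolynomial.var 0).mul (IsStarPolynomial.var 0).star).sub (.const 1)),
        isCompact_singleton⟩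
    · exact ⟨.norm (((IsStarPolynomial.var 0).star.mul (.var 0)).sub (.const 1)),
        isCompact_singleton⟩
    · exact ⟨.norm (((IsStarPolynomial.var k).pow k).sub (.var 0)), isCompact_singleton⟩
    · exact ⟨isFormula_iInf_sphere k, isCompact_Icc⟩

end Formula

/-! ### Approximate realizability and non-realizability of the type -/

namespace Calkin

variable {H : Type*} [NormedAddCommGroup H] [InnerProductSpace ℂ H] [CompleteSpace H]

variable {S : H →L[ℂ] H}

theorem norm_le_one_of_star_mul_self (hS : star S * S = 1) : ‖S‖ ≤ 1 :=
  S.opNorm_le_bound zero_le_one fun v => by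
    rw [one_mul, (ContinuousLinearMap.norm_map_iff_adjoint_comp_self S).2 hS v]

theorem norm_π_pow_le (hS : star S * S = 1) [NormOneClass (CalkinAlgebra H)] (j : ℕ) :
    ‖π H S ^ j‖ ≤ 1 :=
  (norm_pow_le _ j).trans (pow_le_one₀ (norm_nonneg _)
    ((norm_π_le S).trans (norm_le_one_of_star_mul_self hS)))

theorem norm_π_star_pow_le (hS : star S * S = 1) [NormOneClass (CalkinAlgebra H)] (j : ℕ) :
    ‖π H (star S) ^ j‖ ≤ 1 :=
  (norm_pow_le _ j).trans (pow_le_one₀ (norm_nonneg _)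
    ((norm_π_le _).trans ((norm_star S).le.trans (norm_le_one_of_star_mul_self hS))))

variable [FiniteDimensional ℂ (star S).ker]

/-- Powers of the shift that are close to a `k`-th power have exponent divisible by `k`. -/
theorem dvd_of_norm_pow_sub_lt (hS : star S * S = 1) (hS1 : Module.finrank ℂ (star S).ker = 1)
    [NormOneClass (CalkinAlgebra H)] {k m : ℕ} (hk : k ≠ 0) {y : CalkinAlgebra H}
    (hy : ‖y ^ k - π H S ^ m‖ < 1) : k ∣ m := by
  obtain ⟨ind, hker, hind⟩ := exists_index hS hS1
  have hinv : π H S ^ m * π H (star S) ^ m = 1 := by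
    have := (shiftUnit hS ^ m).mul_inv
    rwa [← inv_pow] at this
  have hinv' : π H (star S) ^ m * π H S ^ m = 1 := by
    rw [← map_pow, ← map_pow, ← map_mul, star_pow_mul_pow hS, map_one]
  -- Multiplying by the contraction `s⁻ᵐ` gives an element within distance 1 of the identity, which
  -- lifts to an invertible operator and so has index 0.
  have h1 : ‖y ^ k * π H (star S) ^ m - 1‖ < 1 := by
    rw [← hinv, ← sub_mul]
    refine (norm_mul_le _ _).trans_lt (lt_of_le_of_lt ?_ hy)
    exact mul_le_of_le_one_right (norm_nonneg _) (norm_π_star_pow_le hS m)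
  obtain ⟨V, hV⟩ := exists_unit_lift_of_norm_sub_one_lt h1
  let v : (CalkinAlgebra H)ˣ := Units.map (π H : (H →L[ℂ] H) →* CalkinAlgebra H) V
  have hvy : (v * shiftUnit hS ^ m : (CalkinAlgebra H)ˣ) = y ^ k := by
    change π H V * π H S ^ m = y ^ k
    rw [hV, mul_assoc, hinv', mul_one]
  obtain ⟨u, rfl⟩ := (isUnit_pow_iff hk).1 ⟨_, hvy⟩
  have h2 : v * shiftUnit hS ^ m = u ^ k := Units.ext hvy
  have h3 := congrArg ind h2
  have hv1 : ind v = 1 := by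
    rw [← MonoidHom.mem_ker, hker]
    exact ⟨V, rfl⟩
  rw [map_mul, map_pow, map_pow, hind, hv1, one_mul, ← ofAdd_nsmul] at h3
  have h4 := congrArg Multiplicative.toAdd h3
  rw [toAdd_ofAdd, toAdd_pow, nsmul_eq_mul, mul_one, nsmul_eq_mul] at h4
  exact Int.natCast_dvd_natCast.1 ⟨_, h4⟩

theorem isFinitelyApproximatelyRealizable_rootType (hS : star S * S = 1)
    (hS1 : Module.finrank ℂ (star S).ker = 1) [NormOneClass (CalkinAlgebra H)] (n : Supernatural) :
    IsFinitelyApproximatelyRealizable (rootType (CalkinAlgebra H) n) := by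
  intro T hT hTfin ε hε
  obtain ⟨m, hm, hmT⟩ := exists_common_divisor (n := n) hTfin
  have hu : π H S ^ (m : ℕ) * star (π H S ^ (m : ℕ)) = 1 := by
    rw [star_pow, ← π_star]
    have := (shiftUnit hS ^ (m : ℕ)).mul_inv
    rwa [← inv_pow] at this
  have hu' : star (π H S ^ (m : ℕ)) * π H S ^ (m : ℕ) = 1 := by
    rw [star_pow, ← π_star, ← map_pow, ← map_pow, ← map_mul, star_pow_mul_pow hS, map_one]
  -- These elements satisfy the conditions exactly. When `j` does not divide `m`, the floor power
  -- only fills the slot with an element of the unit ball.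
  refine ⟨fun j => if j = 0 then π H S ^ (m : ℕ) else π H S ^ (m / j : ℕ), fun j => ?_,
    fun c hc => Metric.self_subset_cthickening _ ?_⟩
  · dsimp only
    split_ifs
    exacts [norm_π_pow_le hS _, norm_π_pow_le hS _]
  rcases hT hc with ((rfl | rfl) | hk) | ⟨k, hk, rfl⟩
  · simp only [↓reduceIte, hu, sub_self, norm_zero, Set.mem_singleton_iff]
  · simp only [↓reduceIte, hu', sub_self, norm_zero, Set.mem_singleton_iff]
  · obtain ⟨k, hkm, rfl⟩ := hmT c hc hk
    simp only [k.ne_zero, ↓reduceIte, ← pow_mul, Nat.div_mul_cancel hkm, sub_self, norm_zero,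
      Set.mem_singleton_iff]
  · simp only [↓reduceIte]
    have : Nonempty (Metric.sphere (0 : CalkinAlgebra H) 1) := ⟨⟨1, by simp⟩⟩
    refine ⟨le_ciInf fun y => ?_, ?_⟩
    · by_contra hlt
      exact hk (Supernatural.divides_of_dvd
        (dvd_of_norm_pow_sub_lt hS hS1 k.ne_zero (not_le.1 hlt)) hm)
    · refine ciInf_le_of_le ⟨0, ?_⟩
        (⟨1, by simp⟩ : Metric.sphere (0 : CalkinAlgebra H) 1) ?_
      · rintro _ ⟨y, rfl⟩
        exact norm_nonneg _
      · change ‖(1 : CalkinAlgebra H) ^ (k : ℕ) - π H S ^ (m : ℕ)‖ ≤ 2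
        rw [one_pow]
        have := norm_sub_le (1 : CalkinAlgebra H) (π H S ^ (m : ℕ))
        rw [norm_one] at this
        linarith [norm_π_pow_le hS (m : ℕ)]

theorem not_isRealized_rootType (hH : ¬ FiniteDimensional ℂ H) (hS : star S * S = 1)
    (hS1 : Module.finrank ℂ (star S).ker = 1) {n : Supernatural}
    (hn : ∀ m : ℕ+, n ≠ Supernatural.ofPNat m) (hn' : n ≠ fun _ => ⊤) :
    ¬ IsRealized (rootType (CalkinAlgebra H) n) := by
  rintro ⟨b, -, hb⟩
  obtain ⟨ind, hker, -⟩ := exists_index hS hS1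
  have h1 : b 0 * star (b 0) = 1 := by
    have := hb _ (.inl (.inl (.inl rfl)))
    exact sub_eq_zero.1 (norm_eq_zero.1 this)
  have h2 : star (b 0) * b 0 = 1 := by
    have := hb _ (.inl (.inl (.inr rfl)))
    exact sub_eq_zero.1 (norm_eq_zero.1 this)
  let u : (CalkinAlgebra H)ˣ := ⟨b 0, star (b 0), h1, h2⟩
  have hdvd : ∀ k : ℕ+, (Supernatural.ofPNat k).Divides n → ((k : ℕ) : ℤ) ∣ (ind u).toAdd := by
    intro k hk
    have h3 : b k ^ (k : ℕ) = b 0 :=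
      sub_eq_zero.1 (norm_eq_zero.1 (hb _ (.inl (.inr ⟨k, hk, rfl⟩))))
    obtain ⟨w, hw⟩ := (isUnit_pow_iff k.ne_zero).1 (h3 ▸ u.isUnit : IsUnit (b k ^ (k : ℕ)))
    have h4 : u = w ^ (k : ℕ) := Units.ext (by rw [Units.val_pow_eq_pow_val, hw, h3])
    rw [h4, map_pow, toAdd_pow, nsmul_eq_mul]
    exact ⟨_, rfl⟩
  -- A nonzero index would bound all natural divisors of `n`, making `n` a natural number.
  have hind : ind u = 1 := by
    by_contra hne
    obtain ⟨m, hm⟩ := Supernatural.exists_eq_ofPNat_of_bounded (n := n)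
      (N := (ind u).toAdd.natAbs) fun k hk => Nat.le_of_dvd
        (Int.natAbs_pos.2 fun h => hne (toAdd_eq_zero.1 h)) (Int.natCast_dvd.1 (hdvd k hk))
    exact hn m hm
  rw [← MonoidHom.mem_ker, hker] at hind
  obtain ⟨V, hV⟩ := mem_liftable.1 hind
  have hV' : π H V = b 0 := hV
  obtain ⟨U, hU, hUV⟩ := exists_unitary_lift (V := V) (by rw [hV', h2])
  obtain ⟨k, hk⟩ := Supernatural.exists_not_divides hn'
  obtain ⟨W, hW, hWU⟩ := exists_unitary_root hU k.ne_zero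
  have h5 := (hb _ (.inr ⟨k, hk, rfl⟩)).1
  have h6 : ⨅ y : Metric.sphere (0 : CalkinAlgebra H) 1, ‖(y : CalkinAlgebra H) ^ (k : ℕ) - b 0‖
      ≤ 0 := by
    refine ciInf_le_of_le ⟨0, ?_⟩
      (⟨π H W, by simpa using norm_π_of_mem_unitary hH hW⟩ :
        Metric.sphere (0 : CalkinAlgebra H) 1) ?_
    · rintro _ ⟨y, rfl⟩
      exact norm_nonneg _
    · change ‖π H W ^ (k : ℕ) - b 0‖ ≤ 0
      rw [← map_pow, hWU, hUV, hV', sub_self, norm_zero]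
  exact absurd (h5.trans h6) (by norm_num)

end Calkin

theorem mainTheorem7 {H : Type*} [NormedAddCommGroup H] [InnerProductSpace ℂ H] [CompleteSpace H]
    [TopologicalSpace.SeparableSpace H] (hH : ¬ FiniteDimensional ℂ H) :
    (∀ n : Supernatural,
      IsCountableType (rootType (CalkinAlgebra H) n) ∧
      IsFinitelyApproximatelyRealizable (rootType (CalkinAlgebra H) n)) ∧
    (∀ n : Supernatural, (∀ m : ℕ+, n ≠ Supernatural.ofPNat m) → n ≠ (fun _ => ⊤) →
      ¬ IsRealized (rootType (CalkinAlgebra H) n)) ∧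
    ¬ IsCountablySaturated (CalkinAlgebra H) := by
  have : NormOneClass (CalkinAlgebra H) := ⟨Calkin.norm_one_eq hH⟩
  obtain ⟨S, hS, hS1⟩ := Calkin.exists_shift hH
  have : FiniteDimensional ℂ (star S).ker := Module.finite_of_finrank_eq_succ hS1
  have ha : ∀ n : Supernatural, IsCountableType (rootType (CalkinAlgebra H) n) ∧
      IsFinitelyApproximatelyRealizable (rootType (CalkinAlgebra H) n) := fun n =>
    ⟨isCountableType_rootType n, Calkin.isFinitelyApproximatelyRealizable_rootType hS hS1 n⟩
  have hb : ∀ n : Supernatural, (∀ m : ℕ+, n ≠ Supernatural.ofPNat m) → n ≠ (fun _ => ⊤) →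
      ¬ IsRealized (rootType (CalkinAlgebra H) n) := fun n hn hn' =>
    Calkin.not_isRealized_rootType hH hS hS1 hn hn'
  refine ⟨ha, hb, fun hsat => ?_⟩
  let two : Nat.Primes := ⟨2, Nat.prime_two⟩
  let three : Nat.Primes := ⟨3, Nat.prime_three⟩
  have h23 : three ≠ two := fun h => absurd (congrArg Subtype.val h) (by decide)
  -- The supernatural number `2 ^ ∞`: it is not natural because of the exponent at 2, and 3 does not
  -- divide it.
  let n : Supernatural := Pi.single two ⊤
  refine hb n (fun m h => ?_) (fun h => ?_) ((hsat _ (ha n).1).2 (ha n).2)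
  · have h1 := congrFun h two
    simp only [n, Pi.single_eq_same, Supernatural.ofPNat] at h1
    exact ENat.natCast_ne_top _ h1.symm
  · have h1 := congrFun h three
    simp only [n, Pi.single_eq_of_ne h23] at h1
    exact ENat.zero_ne_top h1
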